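/- Let $\mathcal A$ be a finite set of actions with $|\mathcal A|\ge 2$ and let $\mathcal V$ be a countably infinite set of variables. The terms of $\mathrm{BCCSP}_{\|}$ are given by $$t ::= \mathbf 0 \mid x \mid a.t \mid t+t \mid t\,\|\,t \qquad (a\in\mathcal A,\ x\in\mathcal V),$$ and $\mathcal P$ is the set of closed terms (processes). The transition relations $\xrightarrow{a}$ ($a \in \mathcal A$) on $\mathcal P$ are the least ones such that $a.p\xrightarrow{a}p$; if $p\xrightarrow{a}p'$ then $p+q\xrightarrow{a}p'$, $q+p\xrightarrow{a}p'$, $p\,\|\,q\xrightarrow{a}p'\,\|\,q$ and $q\,\|\,p\xrightarrow{a}q\,\|\,p'$ (pure interleaving, no synchronisation). For $\alpha=a_1\cdots a_k\in\mathcal A^*$, $p\xrightarrow{\alpha}p'$ means $p=p_0\xrightarrow{a_1}p_1\cdots\xrightarrow{a_k}p_k=p'$ for some $p_0,\dots,p_k$. *Nested trace equivalence.* $p\sim^0_{\mathtt T}q$ holds for all $p,q\in\mathcal P$, and $p\sim^{n+1}_{\mathtt T}q$ iff for every $\alpha\in\mathcal A^*$: whenever $p\xrightarrow{\alpha}p'$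 there is $q'$ with $q\xrightarrow{\alpha}q'$ and $p'\sim^n_{\mathtt T}q'$, and whenever $q\xrightarrow{\alpha}q'$ there is $p'$ with $p\xrightarrow{\alpha}p'$ and $p'\sim^n_{\mathtt T}q'$. *Nested simulation equivalence.* A simulation is a relation $\mathcal R\subseteq\mathcal P\times\mathcal P$ such that whenever $p\,\mathcal R\,q$ and $p\xrightarrow{a}p'$ there is $q'$ with $q\xrightarrow{a}q'$ and $p'\,\mathcal R\,q'$. Let $p\sqsubseteq^0_{\mathtt S}q$ hold for all $p,q\in\mathcal P$, and let $p\sqsubseteq^{n+1}_{\mathtt S}q$ iff $p\,\mathcal R\,q$ for some simulation $\mathcal R$ with $\mathcal R^{-1}\subseteq{\sqsubseteq^n_{\mathtt S}}$. Let $p\sim^n_{\mathtt S}q$ iff $p\sqsubseteq^n_{\mathtt S}q$ and $q\sqsubseteq^n_{\mathtt S}p$. *Axiomatisations.* An axiom system $\mathcal E$ is a set of equations $t\approx u$ between (possibly open) terms, and $\mathcal E\vdash t\approx u$ means that $t\approx u$ is derivable from $\mathcal E$ by reflexivity, symmetry, transitivity, substitution and closure under the operators $a.\_$ ($a \in \mathcal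 A$), $+$ and $\|$. For a relation $\mathcal R$ on $\mathcal P$, $\mathcal E$ is sound modulo $\mathcal R$ if $\sigma(t)\,\mathcal R\,\sigma(u)$ for every equation $(t\approx u)\in\mathcal E$ and every substitution $\sigma:\mathcal V\to\mathcal P$; it is ground-complete modulo $\mathcal R$ if $p\,\mathcal R\,q$ implies $\mathcal E\vdash p\approx q$ for all $p,q\in\mathcal P$. **Theorem.** For every $n\ge 2$, there is no finite axiom system over $\mathrm{BCCSP}_{\|}$ that is sound and ground-complete modulo $n$-nested trace equivalence $\sim^n_{\mathtt T}$, and there is no finite axiom system over $\mathrm{BCCSP}_{\|}$ that is sound and ground-complete modulo $n$-nested simulation equivalence $\sim^n_{\mathtt S}$. -/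

import Mathlib

namespace BCCSP

/-- Terms of the language over the actions `A`, with variables indexed by `ℕ`. -/
inductive Term (A : Type*) : Type _ where
  | nil : Term A
  | var : ℕ → Term A
  | pre : A → Term A → Term A
  | sum : Term A → Term A → Term A
  | par : Term A → Term A → Term A

namespace Term

variable {A : Type*}

/-- The term contains no variables. -/
def IsClosed : Term A → Prop
  | nil => True
  | var _ => False
  | pre _ t => t.IsClosed
  | sum t u => t.IsClosed ∧ u.IsClosed
  | par t u => t.IsClosed ∧ u.IsClosed

/-- Application of a substitution to a term. -/
def subst (σ : ℕ → Term A) : Term A → Term A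
  | nil => nil
  | var x => σ x
  | pre a t => pre a (t.subst σ)
  | sum t u => sum (t.subst σ) (u.subst σ)
  | par t u => par (t.subst σ) (u.subst σ)

theorem isClosed_subst {σ : ℕ → Term A} (hσ : ∀ x, (σ x).IsClosed) (t : Term A) :
    (t.subst σ).IsClosed := by
  induction t with
  | nil => trivial
  | var x => exact hσ x
  | pre a t ih => exact ih
  | sum t u iht ihu => exact ⟨iht, ihu⟩
  | par t u iht ihu => exact ⟨iht, ihu⟩

/-- The transitions derivable from the operational rules of prefixing, nondeterministic choice
and interleaving parallel composition (without synchronisation). -/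
inductive Step : Term A → A → Term A → Prop where
  | pre (a : A) (t : Term A) : Step (pre a t) a t
  | sumLeft {t t' : Term A} {a : A} (u : Term A) : Step t a t' → Step (sum t u) a t'
  | sumRight {u u' : Term A} {a : A} (t : Term A) : Step u a u' → Step (sum t u) a u'
  | parLeft {t t' : Term A} {a : A} (u : Term A) : Step t a t' → Step (par t u) a (par t' u)
  | parRight {u u' : Term A} {a : A} (t : Term A) : Step u a u' → Step (par t u) a (par t u')

end Term

/-- Processes: closed terms. -/
def Proc (A : Type*) : Type _ := {t : Term A // t.IsClosed}

/-- The closed instance `σ(t)` of a term `t` under a closed substitution `σ`. -/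
def Term.close {A : Type*} (σ : ℕ → Proc A) (t : Term A) : Proc A :=
  ⟨t.subst (fun x => (σ x).1), Term.isClosed_subst (fun x => (σ x).2) t⟩

namespace Proc

variable {A : Type*}

/-- The labelled transition system on processes. -/
def Step (p : Proc A) (a : A) (p' : Proc A) : Prop := Term.Step p.1 a p'.1

/-- `Steps p α p'`: the process `p` reaches `p'` by performing the sequence of actions `α`. -/
inductive Steps : Proc A → List A → Proc A → Prop where
  | nil (p : Proc A) : Steps p [] p
  | cons {p p' p'' : Proc A} {a : A} {α : List A} :
      Step p a p' → Steps p' α p'' → Steps p (a :: α) p''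

/-- `n`-nested trace equivalence. -/
def NestedTraceEquiv : ℕ → Proc A → Proc A → Prop
  | 0, _, _ => True
  | n + 1, p, q => ∀ α : List A,
      (∀ p', Steps p α p' → ∃ q', Steps q α q' ∧ NestedTraceEquiv n p' q') ∧
      (∀ q', Steps q α q' → ∃ p', Steps p α p' ∧ NestedTraceEquiv n p' q')

/-- Simulations over processes. -/
def IsSimulation (R : Proc A → Proc A → Prop) : Prop :=
  ∀ p q, R p q → ∀ a p', Step p a p' → ∃ q', Step q a q' ∧ R p' q'

/-- The `n`-nested simulation preorder: at level `n + 1`, `p` and `q` are related by some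
simulation whose inverse is included in the preorder of level `n`. -/
def NestedSim : ℕ → Proc A → Proc A → Prop
  | 0, _, _ => True
  | n + 1, p, q => ∃ R : Proc A → Proc A → Prop,
      IsSimulation R ∧ (∀ r s, R r s → NestedSim n s r) ∧ R p q

/-- `n`-nested simulation equivalence, the kernel of the `n`-nested simulation preorder. -/
def NestedSimEquiv (n : ℕ) (p q : Proc A) : Prop := NestedSim n p q ∧ NestedSim n q p

end Proc

/-- An axiom system: a set of equations `t ≈ u`, each given as the pair `(t, u)`. -/
abbrev AxiomSystem (A : Type*) : Type _ := Set (Term A × Term A)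

/-- `Derives E t u`: the equation `t ≈ u` is derivable from `E` by the rules of equational
logic. -/
inductive Derives {A : Type*} (E : AxiomSystem A) : Term A → Term A → Prop where
  | ax {t u : Term A} : (t, u) ∈ E → Derives E t u
  | refl (t : Term A) : Derives E t t
  | symm {t u : Term A} : Derives E t u → Derives E u t
  | trans {t u v : Term A} : Derives E t u → Derives E u v → Derives E t v
  | subst {t u : Term A} (σ : ℕ → Term A) :
      Derives E t u → Derives E (t.subst σ) (u.subst σ)
  | pre {t u : Term A} (a : A) : Derives E t u → Derives E (.pre a t) (.pre a u)
  | sum {t u t' u' : Term A} :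
      Derives E t u → Derives E t' u' → Derives E (.sum t t') (.sum u u')
  | par {t u t' u' : Term A} :
      Derives E t u → Derives E t' u' → Derives E (.par t t') (.par u u')

/-- Every closed instance of every equation of `E` holds modulo `R`. -/
def AxiomSystem.IsSound {A : Type*} (E : AxiomSystem A)
    (R : Proc A → Proc A → Prop) : Prop :=
  ∀ t u, (t, u) ∈ E → ∀ σ : ℕ → Proc A, R (t.close σ) (u.close σ)

/-- All equations between closed terms that hold modulo `R` are derivable from `E`. -/
def AxiomSystem.IsGroundComplete {A : Type*} (E : AxiomSystem A)
    (R : Proc A → Proc A → Prop) : Prop :=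
  ∀ p q : Proc A, R p q → Derives E p.1 q.1

/-- `R` has a finite, sound and ground-complete equational axiomatisation. -/
def HasFiniteGroundCompleteAxiomatisation {A : Type*}
    (R : Proc A → Proc A → Prop) : Prop :=
  ∃ E : AxiomSystem A, E.Finite ∧ E.IsSound R ∧ E.IsGroundComplete R

end BCCSP

/-! The process `a ‖ (bab + ba²b + ⋯ + baᴺb)` has the same transitions as its expansion, a sum of
prefixes, so all the equivalences considered identify the two. Finitely many sound axioms cannot
derive all these equations: some invariant separates the two sides, yet survives every derivation
from axioms with fewer than `N` unguarded prefixes per side.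

From level 2 on, both equivalences are contained in `FutEq`, which matches single transitions up to
trace equality. `FutEq` is a congruence, and soundness enters only through it. The invariant
`HasParSummand` asks for a summand `u ‖ v` with `u` trace equal to `a` and `v` able to move. It is
tracked on processes satisfying `IsConstrained`, a property invariant under `FutEq`.

Let `t ≈ u` be an axiom and let `σ(t)` have such a summand. If its `‖` belongs to `t`, the active
component has `N` traces `baⁱb`, while each of its `b`-derivatives has at most one trace `aⁱb`. A
prefix accounts for one `i` only, and two active parallel components would yield `bb`, so some
unguarded variable can perform `b` (`exists_head_or_finset`). Otherwise the summand lies inside some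
`σ(x)`. In both cases a variable `x` occurs unguarded in `t` beside a context that has the traces of
`a` or cannot move.

Adding the summand `bᵏ⁺¹` to `σ(x)`, with `k` large, marks this occurrence: one `b` leads to `bᵏ` in
parallel with the context, and only an unguarded `x` in `u` can match that. Cancelling `bᵏ` gives an
unguarded `x` in `u` beside a trace-equal context (`Head.transfer`), hence the invariant for `σ(u)`.
-/

namespace BCCSP

/-! ### Traces and interleavings -/

namespace Term

variable {A : Type*}

/-- `t.Tr α`: the term `t` can perform the sequence of actions `α`. -/
def Tr : Term A → List A → Prop
  | _, [] => True
  | t, c :: α => ∃ t', Step t c t' ∧ Tr t' α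

@[simp] theorem tr_nil (t : Term A) : t.Tr [] := by simp [Tr]

theorem tr_cons {t : Term A} {c : A} {α : List A} :
    t.Tr (c :: α) ↔ ∃ t', Step t c t' ∧ t'.Tr α := by simp [Tr]

/-- Equality of trace sets. -/
def TrEq (t u : Term A) : Prop := ∀ α, t.Tr α ↔ u.Tr α

theorem TrEq.refl (t : Term A) : TrEq t t := fun _ => Iff.rfl

theorem TrEq.symm {t u : Term A} (h : TrEq t u) : TrEq u t := fun α => (h α).symm

theorem TrEq.trans {t u v : Term A} (h : TrEq t u) (h' : TrEq u v) : TrEq t v :=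
  fun α => (h α).trans (h' α)

theorem step_nil_iff {c : A} {r : Term A} : Step nil c r ↔ False :=
  ⟨fun h => (nomatch h), False.elim⟩

theorem step_pre_iff {c d : A} {t r : Term A} : Step (pre d t) c r ↔ c = d ∧ r = t := by
  constructor
  · intro h; cases h; exact ⟨rfl, rfl⟩
  · rintro ⟨rfl, rfl⟩; exact .pre _ _

theorem step_sum_iff {c : A} {t u r : Term A} :
    Step (sum t u) c r ↔ Step t c r ∨ Step u c r := by
  constructor
  · intro h
    cases h with
    | sumLeft _ h => exact .inl h
    | sumRight _ h => exact .inr h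
  · rintro (h | h)
    · exact .sumLeft _ h
    · exact .sumRight _ h

theorem step_par_iff {c : A} {t u r : Term A} :
    Step (par t u) c r ↔
      (∃ t', Step t c t' ∧ r = par t' u) ∨ (∃ u', Step u c u' ∧ r = par t u') := by
  constructor
  · intro h
    cases h with
    | parLeft _ h => exact .inl ⟨_, h, rfl⟩
    | parRight _ h => exact .inr ⟨_, h, rfl⟩
  · rintro (⟨t', h, rfl⟩ | ⟨t', h, rfl⟩)
    · exact .parLeft _ h
    · exact .parRight _ h

theorem tr_pre_cons {c d : A} {t : Term A} {α : List A} :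
    (pre d t).Tr (c :: α) ↔ c = d ∧ t.Tr α := by
  simp only [tr_cons, step_pre_iff]
  constructor
  · rintro ⟨_, ⟨rfl, rfl⟩, h⟩; exact ⟨rfl, h⟩
  · rintro ⟨rfl, h⟩; exact ⟨t, ⟨rfl, rfl⟩, h⟩

theorem tr_sum {t u : Term A} {α : List A} : (sum t u).Tr α ↔ t.Tr α ∨ u.Tr α := by
  cases α with
  | nil => simp
  | cons c α => simp only [tr_cons, step_sum_iff, or_and_right, exists_or]

theorem tr_par_cons {t u : Term A} {c : A} {α : List A} :
    (par t u).Tr (c :: α) ↔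
      (∃ t', Step t c t' ∧ (par t' u).Tr α) ∨ (∃ u', Step u c u' ∧ (par t u').Tr α) := by
  simp only [tr_cons, step_par_iff]
  constructor
  · rintro ⟨_, (⟨t', h, rfl⟩ | ⟨t', h, rfl⟩), h'⟩
    · exact .inl ⟨t', h, h'⟩
    · exact .inr ⟨t', h, h'⟩
  · rintro (⟨t', h, h'⟩ | ⟨t', h, h'⟩)
    · exact ⟨_, .inl ⟨t', h, rfl⟩, h'⟩
    · exact ⟨_, .inr ⟨t', h, rfl⟩, h'⟩

/-- `Shuffle α β γ`: the list `γ` is an interleaving of `α` and `β`. -/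
inductive Shuffle : List A → List A → List A → Prop where
  | nil : Shuffle [] [] []
  | left {α β γ : List A} (c : A) : Shuffle α β γ → Shuffle (c :: α) β (c :: γ)
  | right {α β γ : List A} (c : A) : Shuffle α β γ → Shuffle α (c :: β) (c :: γ)

namespace Shuffle

theorem symm {α β γ : List A} (h : Shuffle α β γ) : Shuffle β α γ := by
  induction h with
  | nil => exact .nil
  | left c _ ih => exact .right c ih
  | right c _ ih => exact .left c ih

theorem nil_left (β : List A) : Shuffle [] β β := by
  induction β with
  | nil => exact .nil
  | cons c β ih => exact .right c ih

theorem append (α β : List A) : Shuffle α β (α ++ β) := by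
  induction α with
  | nil => exact nil_left β
  | cons c α ih => exact .left c ih

theorem eq_of_nil_left {α β γ : List A} (h : Shuffle α β γ) (hα : α = []) : γ = β := by
  induction h with
  | nil => rfl
  | left c _ _ => simp at hα
  | right c _ ih => rw [ih hα]

theorem filter {α β γ : List A} (p : A → Bool) (h : Shuffle α β γ) :
    Shuffle (α.filter p) (β.filter p) (γ.filter p) := by
  induction h with
  | nil => exact .nil
  | left c _ ih =>
    by_cases hc : p c
    · simpa [List.filter_cons, hc] using Shuffle.left c ih
    · simpa [List.filter_cons, hc] using ih
  | right c _ ih =>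
    by_cases hc : p c
    · simpa [List.filter_cons, hc] using Shuffle.right c ih
    · simpa [List.filter_cons, hc] using ih

theorem length {α β γ : List A} (h : Shuffle α β γ) : γ.length = α.length + β.length := by
  induction h with
  | nil => rfl
  | left c _ ih => simp [ih]; omega
  | right c _ ih => simp [ih]; omega

theorem count [DecidableEq A] {α β γ : List A} (h : Shuffle α β γ) (b : A) :
    γ.count b = α.count b + β.count b := by
  simpa [List.count_eq_length_filter] using (h.filter (· == b)).length

end Shuffle

theorem tr_par {t u : Term A} {γ : List A} :
    (par t u).Tr γ ↔ ∃ α β, Shuffle α β γ ∧ t.Tr α ∧ u.Tr β := by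
  induction γ generalizing t u with
  | nil => simpa using ⟨[], [], .nil, tr_nil t, tr_nil u⟩
  | cons c γ ih =>
    rw [tr_par_cons]
    constructor
    · rintro (⟨t', h, h'⟩ | ⟨u', h, h'⟩)
      · obtain ⟨α, β, hs, h1, h2⟩ := ih.1 h'
        exact ⟨c :: α, β, .left c hs, ⟨t', h, h1⟩, h2⟩
      · obtain ⟨α, β, hs, h1, h2⟩ := ih.1 h'
        exact ⟨α, c :: β, .right c hs, h1, ⟨u', h, h2⟩⟩
    · rintro ⟨α, β, hs, h1, h2⟩
      cases hs with
      | left _ hs =>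
        obtain ⟨t', h, h1⟩ := h1
        exact .inl ⟨t', h, ih.2 ⟨_, _, hs, h1, h2⟩⟩
      | right _ hs =>
        obtain ⟨u', h, h2⟩ := h2
        exact .inr ⟨u', h, ih.2 ⟨_, _, hs, h1, h2⟩⟩

theorem Tr.par_left {t : Term A} {α : List A} (h : t.Tr α) (u : Term A) : (par t u).Tr α :=
  tr_par.2 ⟨α, [], (Shuffle.nil_left α).symm, h, tr_nil u⟩

theorem Tr.par_right {u : Term A} {α : List A} (h : u.Tr α) (t : Term A) : (par t u).Tr α :=
  tr_par.2 ⟨[], α, Shuffle.nil_left α, tr_nil t, h⟩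

theorem TrEq.par {t u t' u' : Term A} (h : TrEq t u) (h' : TrEq t' u') :
    TrEq (par t t') (par u u') := by
  intro γ
  simp only [tr_par, h _, h' _]

theorem TrEq.par_comm (t u : Term A) : TrEq (.par t u) (.par u t) := by
  intro γ
  simp only [tr_par]
  constructor <;> rintro ⟨α, β, hs, h1, h2⟩ <;> exact ⟨β, α, hs.symm, h2, h1⟩

theorem Tr.par_assoc {t u v : Term A} {γ : List A} (h : (.par (.par t u) v : Term A).Tr γ) :
    (.par t (.par u v) : Term A).Tr γ := by
  induction γ generalizing t u v with
  | nil => simp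
  | cons c γ ih =>
    rcases tr_par_cons.1 h with ⟨r, hr, h⟩ | ⟨v', hv, h⟩
    · rcases step_par_iff.1 hr with ⟨t', ht, rfl⟩ | ⟨u', hu, rfl⟩
      · exact ⟨_, .parLeft _ ht, ih h⟩
      · exact ⟨_, .parRight _ (.parLeft _ hu), ih h⟩
    · exact ⟨_, .parRight _ (.parRight _ hv), ih h⟩

theorem TrEq.par_assoc (t u v : Term A) :
    TrEq (.par (.par t u) v) (.par t (.par u v)) := by
  intro γ
  refine ⟨Tr.par_assoc, fun h => ?_⟩
  -- The converse is the first inclusion conjugated by commutativity: it is applied to `(v ‖ u) ‖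
  -- t`.
  have h1 := (TrEq.par_comm _ _ _).1 (((TrEq.par_comm u v).par (.refl t) _).1
    ((TrEq.par_comm _ _ _).1 h))
  have h2 := (TrEq.par_comm _ _ _).1 (Tr.par_assoc ((TrEq.par_comm _ _ _).1 h1))
  exact ((TrEq.par_comm u t).par (.refl v) _).1 h2

/-! ### Terms with the traces of `0` or of `a.0` -/

/-- The term has no transitions. -/
def Zero (t : Term A) : Prop := ∀ α, t.Tr α → α = []

/-- The term has exactly the traces of `a.0`. -/
def One (a : A) (t : Term A) : Prop := ∀ α, t.Tr α ↔ α = [] ∨ α = [a]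

theorem zero_nil : Zero (nil : Term A) := by
  rintro (_ | ⟨c, α⟩) h
  · rfl
  · obtain ⟨r, h, _⟩ := h
    exact absurd h (by simp [step_nil_iff])

theorem one_pre_nil (a : A) : One a (pre a nil) := by
  rintro (_ | ⟨c, α⟩)
  · simp
  · rw [tr_pre_cons]
    constructor
    · rintro ⟨rfl, h⟩
      rw [zero_nil _ h]; simp
    · intro h
      simp at h
      obtain ⟨rfl, rfl⟩ := h
      simp

theorem TrEq.zero {t u : Term A} (h : TrEq t u) (ht : Zero t) : Zero u :=
  fun α hα => ht α ((h α).2 hα)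

theorem TrEq.one {a : A} {t u : Term A} (h : TrEq t u) (ht : One a t) : One a u :=
  fun α => (h α).symm.trans (ht α)

theorem Zero.trEq_par_left {t : Term A} (h : Zero t) (u : Term A) : TrEq (par t u) u := by
  intro γ
  refine ⟨fun hγ => ?_, fun hγ => hγ.par_right t⟩
  obtain ⟨α, β, hs, h1, h2⟩ := tr_par.1 hγ
  rwa [hs.eq_of_nil_left (h _ h1)]

theorem Zero.trEq_par_right {u : Term A} (h : Zero u) (t : Term A) : TrEq (par t u) t :=
  (TrEq.par_comm t u).trans (h.trEq_par_left t)

theorem zero_par {t u : Term A} : Zero (par t u) ↔ Zero t ∧ Zero u := by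
  constructor
  · exact fun h => ⟨fun α hα => h α (hα.par_left u), fun α hα => h α (hα.par_right t)⟩
  · exact fun ⟨h, h'⟩ => (h.trEq_par_left u).symm.zero h'

theorem exists_step_of_not_zero {t : Term A} (h : ¬ Zero t) : ∃ c r, Step t c r := by
  simp only [Zero, not_forall] at h
  obtain ⟨_ | ⟨c, α⟩, h, hne⟩ := h
  · exact absurd rfl hne
  · obtain ⟨r, h, _⟩ := h
    exact ⟨c, r, h⟩

theorem not_zero_of_step {t r : Term A} {c : A} (h : Step t c r) : ¬ Zero t :=
  fun hz => by simpa using hz [c] ⟨r, h, tr_nil r⟩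

theorem One.not_zero {a : A} {t : Term A} (h : One a t) : ¬ Zero t :=
  fun hz => by simpa using hz [a] ((h _).2 (.inr rfl))

/-- Two components that can both move would give a trace of length two. -/
theorem One.of_par {a : A} {t u : Term A} (h : One a (par t u)) :
    (Zero t ∧ One a u) ∨ (One a t ∧ Zero u) := by
  by_cases ht : Zero t
  · exact .inl ⟨ht, (ht.trEq_par_left u).one h⟩
  by_cases hu : Zero u
  · exact .inr ⟨(hu.trEq_par_right t).one h, hu⟩
  obtain ⟨c, t', ht⟩ := exists_step_of_not_zero ht
  obtain ⟨d, u', hu⟩ := exists_step_of_not_zero hu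
  have : (par t u).Tr [c, d] := ⟨_, .parLeft _ ht, _, .parRight _ hu, tr_nil _⟩
  simp [h _] at this

/-! ### The congruence `FutEq` -/

/-- One-step matching of transitions up to equality of trace sets. -/
def FutEq (t u : Term A) : Prop := ∀ c,
  (∀ r, Step t c r → ∃ r', Step u c r' ∧ TrEq r r') ∧
  (∀ r', Step u c r' → ∃ r, Step t c r ∧ TrEq r r')

namespace FutEq

theorem refl (t : Term A) : FutEq t t :=
  fun _ => ⟨fun r h => ⟨r, h, .refl r⟩, fun r h => ⟨r, h, .refl r⟩⟩

theorem symm {t u : Term A} (h : FutEq t u) : FutEq u t := fun c =>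
  ⟨fun r hr => let ⟨r', h1, h2⟩ := (h c).2 r hr; ⟨r', h1, h2.symm⟩,
    fun r hr => let ⟨r', h1, h2⟩ := (h c).1 r hr; ⟨r', h1, h2.symm⟩⟩

theorem trEq {t u : Term A} (h : FutEq t u) : TrEq t u := by
  rintro (_ | ⟨c, α⟩)
  · simp
  · constructor
    · rintro ⟨r, hr, hα⟩
      obtain ⟨r', h1, h2⟩ := (h c).1 r hr
      exact ⟨r', h1, (h2 α).1 hα⟩
    · rintro ⟨r, hr, hα⟩
      obtain ⟨r', h1, h2⟩ := (h c).2 r hr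
      exact ⟨r', h1, (h2 α).2 hα⟩

theorem of_forall {t u : Term A} {P : Term A → Term A → Prop} (hP : P t u)
    (hs : ∀ t u, P t u → P u t)
    (h : ∀ t u, P t u → ∀ c r, Step t c r → ∃ r', Step u c r' ∧ TrEq r r') : FutEq t u :=
  fun c => ⟨h t u hP c, fun r hr =>
    let ⟨r', h1, h2⟩ := h u t (hs t u hP) c r hr; ⟨r', h1, h2.symm⟩⟩

theorem trans {t u v : Term A} (h : FutEq t u) (h' : FutEq u v) : FutEq t v := by
  refine of_forall (P := fun t v => ∃ u, FutEq t u ∧ FutEq u v) ⟨u, h, h'⟩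
    (fun t v ⟨u, h, h'⟩ => ⟨u, h'.symm, h.symm⟩) ?_
  rintro t v ⟨u, h, h'⟩ c r hr
  obtain ⟨r1, h1, h2⟩ := (h c).1 r hr
  obtain ⟨r2, h3, h4⟩ := (h' c).1 r1 h1
  exact ⟨r2, h3, h2.trans h4⟩

theorem pre {t u : Term A} (d : A) (h : FutEq t u) : FutEq (.pre d t) (.pre d u) := by
  refine of_forall (P := fun p q => ∃ t u, FutEq t u ∧ p = .pre d t ∧ q = .pre d u)
    ⟨t, u, h, rfl, rfl⟩ (fun p q ⟨t, u, h, h1, h2⟩ => ⟨u, t, h.symm, h2, h1⟩) ?_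
  rintro _ _ ⟨t, u, h, rfl, rfl⟩ c r hr
  obtain ⟨rfl, rfl⟩ := step_pre_iff.1 hr
  exact ⟨u, .pre _ _, h.trEq⟩

theorem sum {t u t' u' : Term A} (h : FutEq t u) (h' : FutEq t' u') :
    FutEq (.sum t t') (.sum u u') := by
  refine of_forall
    (P := fun p q => ∃ t u t' u', FutEq t u ∧ FutEq t' u' ∧ p = .sum t t' ∧ q = .sum u u')
    ⟨t, u, t', u', h, h', rfl, rfl⟩
    (fun p q ⟨t, u, t', u', h, h', h1, h2⟩ => ⟨u, t, u', t', h.symm, h'.symm, h2, h1⟩) ?_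
  rintro _ _ ⟨t, u, t', u', h, h', rfl, rfl⟩ c r hr
  rcases step_sum_iff.1 hr with hr | hr
  · obtain ⟨r', h1, h2⟩ := (h c).1 r hr
    exact ⟨r', .sumLeft _ h1, h2⟩
  · obtain ⟨r', h1, h2⟩ := (h' c).1 r hr
    exact ⟨r', .sumRight _ h1, h2⟩

/-- Only one component moves; the one at rest is compared by its traces, which `FutEq` determines.
-/
theorem par {t u t' u' : Term A} (h : FutEq t u) (h' : FutEq t' u') :
    FutEq (.par t t') (.par u u') := by
  refine of_forall
    (P := fun p q => ∃ t u t' u', FutEq t u ∧ FutEq t' u' ∧ p = .par t t' ∧ q = .par u u')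
    ⟨t, u, t', u', h, h', rfl, rfl⟩
    (fun p q ⟨t, u, t', u', h, h', h1, h2⟩ => ⟨u, t, u', t', h.symm, h'.symm, h2, h1⟩) ?_
  rintro _ _ ⟨t, u, t', u', h, h', rfl, rfl⟩ c r hr
  rcases step_par_iff.1 hr with ⟨r₀, hr₀, rfl⟩ | ⟨r₀, hr₀, rfl⟩
  · obtain ⟨r', h1, h2⟩ := (h c).1 r₀ hr₀
    exact ⟨_, .parLeft _ h1, h2.par h'.trEq⟩
  · obtain ⟨r', h1, h2⟩ := (h' c).1 r₀ hr₀
    exact ⟨_, .parRight _ h1, h.trEq.par h2⟩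

end FutEq

/-! ### Depth, and guarded and unguarded occurrences of variables -/

/-- An upper bound on the length of the traces of a term. -/
def depth : Term A → ℕ
  | nil => 0
  | var _ => 0
  | pre _ t => t.depth + 1
  | sum t u => max t.depth u.depth
  | par t u => t.depth + u.depth

theorem Step.depth_lt {t r : Term A} {c : A} (h : Step t c r) : r.depth < t.depth := by
  induction h with
  | pre => simp [depth]
  | sumLeft _ _ ih => simp [depth]; omega
  | sumRight _ _ ih => simp [depth]; omega
  | parLeft _ _ ih => simp [depth]; omega
  | parRight _ _ ih => simp [depth]; omega

theorem Tr.length_le {t : Term A} {α : List A} (h : t.Tr α) : α.length ≤ t.depth := by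
  induction α generalizing t with
  | nil => simp
  | cons c α ih =>
    obtain ⟨r, hr, h⟩ := h
    have := hr.depth_lt
    have := ih h
    simp; omega

/-- The variable `x` occurs in the term. -/
def Occurs (x : ℕ) : Term A → Prop
  | nil => False
  | var y => y = x
  | pre _ t => t.Occurs x
  | sum t u => t.Occurs x ∨ u.Occurs x
  | par t u => t.Occurs x ∨ u.Occurs x

/-- No operator blocks actions, so every occurrence is reached by performing the prefixes `α'` that
guard it. -/
theorem Occurs.exists_tr {x : ℕ} {t : Term A} (h : t.Occurs x) {σ : ℕ → Term A} {α : List A}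
    (hα : (σ x).Tr α) : ∃ α', (t.subst σ).Tr (α' ++ α) := by
  induction t with
  | nil => exact h.elim
  | var y => cases h; exact ⟨[], hα⟩
  | pre c t ih =>
    obtain ⟨α', h'⟩ := ih h
    exact ⟨c :: α', tr_pre_cons.2 ⟨rfl, h'⟩⟩
  | sum t u iht ihu =>
    rcases h with h | h
    · obtain ⟨α', h'⟩ := iht h
      exact ⟨α', tr_sum.2 (.inl h')⟩
    · obtain ⟨α', h'⟩ := ihu h
      exact ⟨α', tr_sum.2 (.inr h')⟩
  | par t u iht ihu =>
    rcases h with h | h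
    · obtain ⟨α', h'⟩ := iht h
      exact ⟨α', h'.par_left _⟩
    · obtain ⟨α', h'⟩ := ihu h
      exact ⟨α', h'.par_right _⟩

theorem subst_update_of_not_occurs {x : ℕ} {t : Term A} (h : ¬ t.Occurs x) (σ : ℕ → Term A)
    (p : Term A) : t.subst (Function.update σ x p) = t.subst σ := by
  induction t with
  | nil => rfl
  | var y => exact Function.update_of_ne h _ _
  | pre c t ih => simp only [subst]; rw [ih h]
  | sum t u iht ihu =>
    simp only [Occurs, not_or] at h
    simp only [subst]; rw [iht h.1, ihu h.2]
  | par t u iht ihu =>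
    simp only [Occurs, not_or] at h
    simp only [subst]; rw [iht h.1, ihu h.2]

/-- `Head x t s`: the variable `x` occurs in `t` outside the scope of prefixes, and `s` is the
parallel composition of the terms running in parallel with that occurrence. -/
inductive Head (x : ℕ) : Term A → Term A → Prop where
  | var : Head x (var x) nil
  | sumLeft {t s : Term A} (u : Term A) : Head x t s → Head x (sum t u) s
  | sumRight {u s : Term A} (t : Term A) : Head x u s → Head x (sum t u) s
  | parLeft {t s : Term A} (u : Term A) : Head x t s → Head x (par t u) (par s u)
  | parRight {u s : Term A} (t : Term A) : Head x u s → Head x (par t u) (par s t)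

theorem Head.exists_step {x : ℕ} {t s : Term A} (h : Head x t s) {σ : ℕ → Term A} {c : A}
    {q : Term A} (hq : Step (σ x) c q) :
    ∃ r, Step (t.subst σ) c r ∧ TrEq r (par q (s.subst σ)) := by
  induction h with
  | var => exact ⟨q, hq, (zero_nil.trEq_par_right q).symm⟩
  | sumLeft _ _ ih =>
    obtain ⟨r, h1, h2⟩ := ih
    exact ⟨r, .sumLeft _ h1, h2⟩
  | sumRight _ _ ih =>
    obtain ⟨r, h1, h2⟩ := ih
    exact ⟨r, .sumRight _ h1, h2⟩
  | parLeft u _ ih =>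
    obtain ⟨r, h1, h2⟩ := ih
    exact ⟨_, .parLeft _ h1, (h2.par (.refl _)).trans (.par_assoc _ _ _)⟩
  | parRight t _ ih =>
    obtain ⟨r, h1, h2⟩ := ih
    exact ⟨_, .parRight _ h1,
      (TrEq.par_comm _ _).trans ((h2.par (.refl _)).trans (.par_assoc _ _ _))⟩

/-! ### Marking a head occurrence by a long sequence of `b`s -/

/-- The process that performs `a` exactly `k` times, followed by `t`. -/
def prePow (a : A) : ℕ → Term A → Term A
  | 0, t => t
  | k + 1, t => pre a (prePow a k t)

theorem isClosed_prePow (a : A) (k : ℕ) {t : Term A} (h : t.IsClosed) :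
    (prePow a k t).IsClosed := by
  induction k with
  | zero => exact h
  | succ k ih => exact ih

theorem tr_prePow_nil {b : A} {k : ℕ} {α : List A} :
    (prePow b k nil).Tr α ↔ ∃ j ≤ k, α = List.replicate j b := by
  induction k generalizing α with
  | zero =>
    constructor
    · intro h; exact ⟨0, le_rfl, zero_nil _ h⟩
    · rintro ⟨j, hj, rfl⟩
      obtain rfl : j = 0 := by omega
      simp
  | succ k ih =>
    cases α with
    | nil => simp only [tr_nil, true_iff]; exact ⟨0, by omega, rfl⟩
    | cons c α =>
      rw [prePow, tr_pre_cons, ih]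
      constructor
      · rintro ⟨rfl, j, hj, rfl⟩
        exact ⟨j + 1, by omega, rfl⟩
      · rintro ⟨_ | j, hj, h⟩
        · simp at h
        · simp only [List.replicate_succ, List.cons.injEq] at h
          exact ⟨h.1, j, by omega, h.2⟩

section

variable [DecidableEq A]

/-- A step lowers the depth, so no trace of `q` is long enough to contain more than `d` letters `b`.
-/
theorem Step.not_trEq_of_depth_lt_count {p q r : Term A} {b : A} {d : ℕ} (h : Step p b q)
    (hp : p.depth ≤ d) (hr : ∃ α, r.Tr α ∧ d < α.count b) : ¬ TrEq r q := by
  intro he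
  obtain ⟨α, h1, h2⟩ := hr
  have := ((he α).1 h1).length_le
  have := h.depth_lt
  have := List.count_le_length (a := b) (l := α)
  omega

theorem Occurs.exists_tr_count {x : ℕ} {t : Term A} (h : t.Occurs x) {σ : ℕ → Term A} {b : A}
    {m : ℕ} (p : Term A) :
    ∃ α, (t.subst (Function.update σ x (sum p (prePow b m nil)))).Tr α ∧ m ≤ α.count b := by
  obtain ⟨α, hα⟩ := h.exists_tr (σ := Function.update σ x (sum p (prePow b m nil)))
    (α := List.replicate m b) (by
      rw [Function.update_self]
      exact tr_sum.2 (.inr (tr_prePow_nil.2 ⟨m, le_rfl, rfl⟩)))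
  exact ⟨_, hα, by simp⟩

/-- A transition to a term that can perform many `b`s, but fewer than `m`, after `b^m` has been
added to `σ x`, stems from a head occurrence of `x`. -/
theorem exists_head_of_step {σ : ℕ → Term A} {x : ℕ} {b : A} {k : ℕ} {u r : Term A}
    (hr : Step (u.subst (Function.update σ x (sum (σ x) (prePow b (k + 1) nil)))) b r)
    (hle : ∀ α, r.Tr α → α.count b ≤ k)
    (hge : ∃ α, r.Tr α ∧ (u.subst σ).depth < α.count b) :
    ∃ s, Head x u s ∧ TrEq r (par (prePow b k nil) (s.subst σ)) := by
  -- Any occurrence of `x` in `w`, guarded or not, would make all `k + 1` letters `b` of the new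
  -- summand available.
  have hocc : ∀ {w : Term A}, (∀ α, (w.subst (Function.update σ x
      (sum (σ x) (prePow b (k + 1) nil)))).Tr α → α.count b ≤ k) → ¬ w.Occurs x := by
    intro w hw h
    obtain ⟨α, h1, h2⟩ := h.exists_tr_count (σ := σ) (b := b) (m := k + 1) (σ x)
    have := hw α h1
    omega
  induction u generalizing r with
  | nil => cases hr
  | var y =>
    by_cases hy : y = x
    · subst hy
      simp only [subst, Function.update_self] at hr
      rcases step_sum_iff.1 hr with hr | hr
      · exact (hr.not_trEq_of_depth_lt_count le_rfl hge (.refl _)).elim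
      · obtain ⟨-, rfl⟩ := step_pre_iff.1 hr
        exact ⟨nil, .var, (zero_nil.trEq_par_right _).symm⟩
    · simp only [subst, Function.update_of_ne hy] at hr
      exact (hr.not_trEq_of_depth_lt_count le_rfl hge (.refl _)).elim
  | pre c w _ =>
    obtain ⟨rfl, rfl⟩ := step_pre_iff.1 hr
    -- Without `x`, the derivative is also one of the original instance, hence too shallow.
    have hw := hocc hle
    refine ((Step.pre b (w.subst σ)).not_trEq_of_depth_lt_count le_rfl hge ?_).elim
    rw [subst_update_of_not_occurs hw]
    exact .refl _
  | sum u₁ u₂ ih₁ ih₂ =>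
    obtain ⟨α, h1, h2⟩ := hge
    simp only [subst, depth] at h2
    rcases step_sum_iff.1 hr with hr | hr
    · obtain ⟨s, h3, h4⟩ := ih₁ hr hle ⟨α, h1, by omega⟩
      exact ⟨s, .sumLeft _ h3, h4⟩
    · obtain ⟨s, h3, h4⟩ := ih₂ hr hle ⟨α, h1, by omega⟩
      exact ⟨s, .sumRight _ h3, h4⟩
  | par u₁ u₂ ih₁ ih₂ =>
    -- The component at rest contributes at most its depth in `b`s, so both bounds pass to the
    -- moving component.
    have key : ∀ {v r' : Term A}, (∀ α, (par r' (v.subst σ)).Tr α → α.count b ≤ k) →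
        ∀ d, (∃ α, (par r' (v.subst σ)).Tr α ∧ d + (v.subst σ).depth < α.count b) →
        (∀ α, r'.Tr α → α.count b ≤ k) ∧ (∃ α, r'.Tr α ∧ d < α.count b) := by
      rintro v r' hv d ⟨γ, h1, h2⟩
      refine ⟨fun α hα => hv α (hα.par_left _), ?_⟩
      obtain ⟨α, β, hs, h3, h4⟩ := tr_par.1 h1
      have := hs.count b
      have := h4.length_le
      have := List.count_le_length (a := b) (l := β)
      exact ⟨α, h3, by omega⟩
    rcases step_par_iff.1 hr with ⟨r', hr', rfl⟩ | ⟨r', hr', rfl⟩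
    · have hw : ¬ u₂.Occurs x := hocc fun α hα => hle α (hα.par_right _)
      rw [subst_update_of_not_occurs hw] at hle hge ⊢
      obtain ⟨h1, h2⟩ := key hle (u₁.subst σ).depth hge
      obtain ⟨s, h3, h4⟩ := ih₁ hr' h1 h2
      exact ⟨_, .parLeft _ h3, (h4.par (.refl _)).trans (.par_assoc _ _ _)⟩
    · have hw : ¬ u₁.Occurs x := hocc fun α hα => hle α (hα.par_left _)
      have hle' := fun α hα => hle α ((TrEq.par_comm _ _ α).2 hα)
      obtain ⟨α, hge1, hge2⟩ := hge
      have hge1 := (TrEq.par_comm _ _ α).1 hge1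
      rw [subst_update_of_not_occurs hw] at hle' hge1 ⊢
      obtain ⟨h1, h2⟩ := key hle' (u₂.subst σ).depth ⟨α, hge1, by
        simp only [subst, depth] at hge2; omega⟩
      obtain ⟨s, h3, h4⟩ := ih₂ hr' h1 h2
      exact ⟨_, .parRight _ h3, (TrEq.par_comm _ _).trans
        ((h4.par (.refl _)).trans (.par_assoc _ _ _))⟩

/-- In the trace `bᵏα`, every `b` must come from the left component, which has at most `k`; so `α`
contains no `b`, and erasing all `b`s from the interleaving recovers `α` as a trace of `s`. -/
theorem tr_of_tr_par_prePow {b : A} {k : ℕ} {s s' : Term A}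
    (hb : ∀ α, s.Tr α → b ∉ α)
    (h : TrEq (par (prePow b k nil) s) (par (prePow b k nil) s')) {α : List A}
    (hα : s'.Tr α) : s.Tr α := by
  have h1 : (par (prePow b k nil) s).Tr (List.replicate k b ++ α) :=
    (h _).2 (tr_par.2 ⟨_, _, .append _ _, tr_prePow_nil.2 ⟨k, le_rfl, rfl⟩, hα⟩)
  obtain ⟨δ, β, hs, h2, h3⟩ := tr_par.1 h1
  obtain ⟨j, hj, rfl⟩ := tr_prePow_nil.1 h2
  have hcount := hs.count b
  have hβ : β.count b = 0 := List.count_eq_zero.2 (hb β h3)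
  simp only [List.count_append, List.count_replicate_self, hβ] at hcount
  have hα0 : α.count b = 0 := by omega
  have hf := (hs.filter (fun c => decide (c ≠ b))).eq_of_nil_left (by simp)
  rw [List.filter_append] at hf
  have e1 : α.filter (fun c => decide (c ≠ b)) = α := List.filter_eq_self.2 fun c hc => by
    simp only [decide_eq_true_eq]
    rintro rfl
    exact List.count_eq_zero.1 hα0 hc
  have e2 : β.filter (fun c => decide (c ≠ b)) = β := List.filter_eq_self.2 fun c hc => by
    simp only [decide_eq_true_eq]
    rintro rfl
    exact hb β h3 hc
  rw [e1, e2] at hf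
  have : α = β := by simpa using hf
  rwa [this]

theorem trEq_of_trEq_par_prePow {b : A} {k : ℕ} {s s' : Term A}
    (hb : ∀ α, s.Tr α → b ∉ α)
    (h : TrEq (par (prePow b k nil) s) (par (prePow b k nil) s')) : TrEq s s' :=
  fun _ => ⟨fun hα => tr_of_tr_par_prePow
    (fun β hβ => hb β (tr_of_tr_par_prePow hb h hβ)) h.symm hα, tr_of_tr_par_prePow hb h⟩

/-- Equations that are valid modulo `FutEq` have the same head occurrences of variables. -/
theorem Head.transfer {t u s : Term A} {x : ℕ} {b : A} (hs : Head x t s)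
    (h : ∀ σ : ℕ → Term A, (∀ y, (σ y).IsClosed) → FutEq (t.subst σ) (u.subst σ))
    {σ : ℕ → Term A} (hσ : ∀ y, (σ y).IsClosed) (hx : ¬ s.Occurs x)
    (hb : ∀ α, (s.subst σ).Tr α → b ∉ α) :
    ∃ s', Head x u s' ∧ TrEq (s.subst σ) (s'.subst σ) := by
  -- The summand has `k + 1` letters so that `k` remain after the step, more than any trace of
  -- `u.subst σ` can contain.
  set k := (u.subst σ).depth + 1 with hk
  set τ := Function.update σ x (sum (σ x) (prePow b (k + 1) nil)) with hτ
  have hτc : ∀ y, (τ y).IsClosed := by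
    intro y
    by_cases hy : y = x
    · subst hy
      rw [hτ, Function.update_self]
      exact ⟨hσ y, isClosed_prePow b _ trivial⟩
    · rw [hτ, Function.update_of_ne hy]
      exact hσ y
  have hstep : Step (τ x) b (prePow b k nil) := by
    rw [hτ, Function.update_self]
    exact .sumRight _ (.pre _ _)
  obtain ⟨r, h1, h2⟩ := hs.exists_step hstep
  rw [hτ, subst_update_of_not_occurs hx] at h2
  obtain ⟨r', h3, h4⟩ := (h τ hτc b).1 r h1
  have h5 := h4.symm.trans h2
  obtain ⟨s', h6, h7⟩ := exists_head_of_step h3 (fun α hα => by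
    obtain ⟨δ, β, hsh, h8, h9⟩ := tr_par.1 ((h5 α).1 hα)
    obtain ⟨j, hj, rfl⟩ := tr_prePow_nil.1 h8
    rw [hsh.count b, List.count_eq_zero.2 (hb β h9), List.count_replicate_self]
    omega) ⟨List.replicate k b, (h5 _).2 ((tr_prePow_nil.2 ⟨k, le_rfl, rfl⟩).par_left _), by
      rw [List.count_replicate_self]; omega⟩
  exact ⟨s', h6, trEq_of_trEq_par_prePow hb (h5.symm.trans h7)⟩

end

theorem Head.not_zero {x : ℕ} {t s : Term A} (h : Head x t s) {σ : ℕ → Term A}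
    (hx : ¬ Zero (σ x)) : ¬ Zero (t.subst σ) := by
  obtain ⟨c, q, hq⟩ := exists_step_of_not_zero hx
  obtain ⟨r, hr, -⟩ := h.exists_step hq
  exact not_zero_of_step hr

/-! ### The invariant -/

/-- Up to parallel components without transitions, the term has a summand `u ‖ v` in which one
component has the traces of `a.0` and the other one has a transition. -/
def HasParSummand (a : A) : Term A → Prop
  | nil => False
  | var _ => False
  | pre _ _ => False
  | sum t u => t.HasParSummand a ∨ u.HasParSummand a
  | par t u => (Zero t ∧ u.HasParSummand a) ∨ (t.HasParSummand a ∧ Zero u) ∨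
      (One a t ∧ ¬ Zero u) ∨ (¬ Zero t ∧ One a u)

theorem HasParSummand.not_zero {a : A} {t : Term A} (h : t.HasParSummand a) : ¬ Zero t := by
  induction t with
  | nil => exact h.elim
  | var _ => exact h.elim
  | pre _ _ _ => exact h.elim
  | sum t u iht ihu =>
    intro hz
    rcases h with h | h
    · exact iht h fun α hα => hz α (tr_sum.2 (.inl hα))
    · exact ihu h fun α hα => hz α (tr_sum.2 (.inr hα))
  | par t u iht ihu =>
    rw [zero_par]
    rcases h with ⟨-, h⟩ | ⟨h, -⟩ | ⟨-, h⟩ | ⟨h, -⟩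
    · exact fun hz => ihu h hz.2
    · exact fun hz => iht h hz.1
    · exact fun hz => h hz.2
    · exact fun hz => h hz.1

/-- When the context has the traces of `a`, follow the `‖`s outwards from `x`: the component that
contributes the `a` forms the required summand at its `‖`, and all other components cannot move. -/
theorem Head.hasParSummand {a : A} {x : ℕ} {t s : Term A} (h : Head x t s) {σ : ℕ → Term A}
    (hs : (One a (s.subst σ) ∧ ¬ Zero (σ x)) ∨ (Zero (s.subst σ) ∧ (σ x).HasParSummand a)) :
    (t.subst σ).HasParSummand a := by
  induction h with
  | var =>
    rcases hs with hs | hs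
    · exact (hs.1.not_zero zero_nil).elim
    · exact hs.2
  | sumLeft _ _ ih => exact .inl (ih hs)
  | sumRight _ _ ih => exact .inr (ih hs)
  | parLeft u h ih =>
    rcases hs with ⟨h1, h2⟩ | ⟨h1, h2⟩
    · rcases h1.of_par with ⟨h3, h4⟩ | ⟨h3, h4⟩
      · exact .inr (.inr (.inr ⟨h.not_zero h2, h4⟩))
      · exact .inr (.inl ⟨ih (.inl ⟨h3, h2⟩), h4⟩)
    · obtain ⟨h3, h4⟩ := zero_par.1 h1
      exact .inr (.inl ⟨ih (.inr ⟨h3, h2⟩), h4⟩)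
  | parRight u h ih =>
    rcases hs with ⟨h1, h2⟩ | ⟨h1, h2⟩
    · rcases h1.of_par with ⟨h3, h4⟩ | ⟨h3, h4⟩
      · exact .inr (.inr (.inl ⟨h4, h.not_zero h2⟩))
      · exact .inl ⟨h4, ih (.inl ⟨h3, h2⟩)⟩
    · obtain ⟨h3, h4⟩ := zero_par.1 h1
      exact .inl ⟨h4, ih (.inr ⟨h3, h2⟩)⟩

/-! ### Counting prefixes -/

/-- The number of prefixes outside the scope of other prefixes. -/
def numPrefixes : Term A → ℕ
  | nil => 0
  | var _ => 0
  | pre _ _ => 1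
  | sum t u => t.numPrefixes + u.numPrefixes
  | par t u => t.numPrefixes + u.numPrefixes

/-- The trace `aⁱ⁺¹ b`. -/
def wordOf (a b : A) (i : ℕ) : List A := List.replicate (i + 1) a ++ [b]

theorem wordOf_append_inj {a b : A} (hab : a ≠ b) {i j : ℕ} {α β : List A}
    (h : wordOf a b i ++ α = wordOf a b j ++ β) : i = j ∧ α = β := by
  induction i generalizing j with
  | zero =>
    cases j with
    | zero => simpa [wordOf] using h
    | succ j => simp [wordOf, List.replicate_succ, hab.symm] at h
  | succ i ih =>
    cases j with
    | zero => simp [wordOf, List.replicate_succ, hab] at h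
    | succ j =>
      have : wordOf a b i ++ α = wordOf a b j ++ β := by
        simpa [wordOf, List.replicate_succ (n := i + 1), List.replicate_succ (n := j + 1)]
          using h
      obtain ⟨hij, h⟩ := ih this
      exact ⟨congrArg (· + 1) hij, h⟩

/-- If `σ v` has only `b`-transitions, no trace `bb`, and each of its `b`-derivatives has at most
one trace `aⁱ⁺¹ b`, then many traces `b aⁱ⁺¹ b` of `σ v` must be due to a variable. -/
theorem exists_head_or_finset {a b : A} {σ : ℕ → Term A} {v : Term A}
    (h1 : ∀ c, (v.subst σ).Tr [c] → c = b) (h2 : ¬ (v.subst σ).Tr [b, b])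
    (h3 : ∀ r, Step (v.subst σ) b r → ∀ i j, r.Tr (wordOf a b i) → r.Tr (wordOf a b j) → i = j) :
    (∃ x s, Head x v s ∧ Zero (s.subst σ) ∧ (σ x).Tr [b]) ∨
      ∃ F : Finset ℕ, F.card ≤ v.numPrefixes ∧
        ∀ i, (v.subst σ).Tr (b :: wordOf a b i) → i ∈ F := by
  induction v with
  | nil =>
    refine .inr ⟨∅, le_rfl, fun i hi => ?_⟩
    simpa using zero_nil _ hi
  | var x =>
    by_cases hx : (σ x).Tr [b]
    · exact .inl ⟨x, nil, .var, zero_nil, hx⟩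
    · refine .inr ⟨∅, le_rfl, fun i ⟨r, hr, _⟩ => (hx ⟨r, hr, tr_nil r⟩).elim⟩
  | pre c w _ =>
    right
    by_cases hi : ∃ i, (pre c (w.subst σ)).Tr (b :: wordOf a b i)
    · obtain ⟨i, hi⟩ := hi
      -- A prefix has a single derivative, which by `h3` accounts for one index only.
      refine ⟨{i}, le_rfl, fun j hj => ?_⟩
      obtain ⟨rfl, hi'⟩ := tr_pre_cons.1 hi
      rw [Finset.mem_singleton]
      exact h3 _ (.pre _ _) j i (tr_pre_cons.1 hj).2 hi'
    · exact ⟨∅, by simp, fun i h => (hi ⟨i, h⟩).elim⟩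
  | sum v w ihv ihw =>
    rcases ihv (fun c hc => h1 c (tr_sum.2 (.inl hc))) (fun h => h2 (tr_sum.2 (.inl h)))
      (fun r hr => h3 r (.sumLeft _ hr)) with ⟨x, s, hs, h⟩ | ⟨F, hF, hF'⟩
    · exact .inl ⟨x, s, .sumLeft _ hs, h⟩
    rcases ihw (fun c hc => h1 c (tr_sum.2 (.inr hc))) (fun h => h2 (tr_sum.2 (.inr h)))
      (fun r hr => h3 r (.sumRight _ hr)) with ⟨x, s, hs, h⟩ | ⟨F', hG, hG'⟩
    · exact .inl ⟨x, s, .sumRight _ hs, h⟩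
    refine .inr ⟨F ∪ F', (Finset.card_union_le _ _).trans (Nat.add_le_add hF hG), fun i hi => ?_⟩
    rw [Finset.mem_union]
    exact (tr_sum.1 hi).imp (hF' i) (hG' i)
  | par v w ihv ihw =>
    by_cases hv : Zero (v.subst σ)
    · have e := hv.trEq_par_left (w.subst σ)
      rcases ihw (fun c hc => h1 c ((e _).2 hc)) (fun h => h2 ((e _).2 h))
        (fun r hr i j hi hj => h3 _ (.parRight _ hr) i j (hi.par_right _) (hj.par_right _))
        with ⟨x, s, hs, h, h'⟩ | ⟨F, hF, hF'⟩
      · exact .inl ⟨x, _, .parRight _ hs, zero_par.2 ⟨h, hv⟩, h'⟩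
      · exact .inr ⟨F, hF.trans (Nat.le_add_left _ _), fun i hi => hF' i ((e _).1 hi)⟩
    by_cases hw : Zero (w.subst σ)
    · have e := hw.trEq_par_right (v.subst σ)
      rcases ihv (fun c hc => h1 c ((e _).2 hc)) (fun h => h2 ((e _).2 h))
        (fun r hr i j hi hj => h3 _ (.parLeft _ hr) i j (hi.par_left _) (hj.par_left _))
        with ⟨x, s, hs, h, h'⟩ | ⟨F, hF, hF'⟩
      · exact .inl ⟨x, _, .parLeft _ hs, zero_par.2 ⟨h, hw⟩, h'⟩
      · exact .inr ⟨F, hF.trans (Nat.le_add_right _ _), fun i hi => hF' i ((e _).1 hi)⟩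
    -- Two active components would both start with `b` and so produce the forbidden trace `bb`.
    obtain ⟨c, r, hr⟩ := exists_step_of_not_zero hv
    obtain ⟨d, r', hr'⟩ := exists_step_of_not_zero hw
    obtain rfl := h1 c ⟨_, .parLeft _ hr, tr_nil _⟩
    obtain rfl := h1 d ⟨_, .parRight _ hr', tr_nil _⟩
    exact (h2 ⟨_, .parLeft _ hr, _, .parRight _ hr', tr_nil _⟩).elim

/-! ### The separating family of processes -/

/-- The process `aⁱ⁺¹ b`. -/
def wordProc (a b : A) (i : ℕ) : Term A := prePow a (i + 1) (pre b nil)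

/-- The process `b a b + b a² b + ⋯ + b aᴺ b`. -/
def wordSum (a b : A) : ℕ → Term A
  | 0 => nil
  | N + 1 => sum (wordSum a b N) (pre b (wordProc a b N))

/-- The process `∑ b (a ‖ aⁱ b)`, the sum ranging over `1 ≤ i ≤ N`. -/
def parWordSum (a b : A) : ℕ → Term A
  | 0 => nil
  | N + 1 => sum (parWordSum a b N) (pre b (par (pre a nil) (wordProc a b N)))

theorem step_wordSum {a b c : A} {N : ℕ} {r : Term A} :
    Step (wordSum a b N) c r ↔ c = b ∧ ∃ i < N, r = wordProc a b i := by
  induction N with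
  | zero => simp [wordSum, step_nil_iff]
  | succ N ih =>
    rw [wordSum, step_sum_iff, step_pre_iff, ih]
    simp only [Nat.lt_succ_iff_lt_or_eq, or_and_right, exists_or, exists_eq_left, and_or_left]

theorem step_parWordSum {a b c : A} {N : ℕ} {r : Term A} :
    Step (parWordSum a b N) c r ↔
      c = b ∧ ∃ i < N, r = par (pre a nil) (wordProc a b i) := by
  induction N with
  | zero => simp [parWordSum, step_nil_iff]
  | succ N ih =>
    rw [parWordSum, step_sum_iff, step_pre_iff, ih]
    simp only [Nat.lt_succ_iff_lt_or_eq, or_and_right, exists_or, exists_eq_left, and_or_left]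

theorem tr_prePow_append {a : A} {k : ℕ} {t : Term A} {α : List A} (h : t.Tr α) :
    (prePow a k t).Tr (List.replicate k a ++ α) := by
  induction k with
  | zero => exact h
  | succ k ih => exact tr_pre_cons.2 ⟨rfl, ih⟩

theorem tr_wordProc (a b : A) (i : ℕ) : (wordProc a b i).Tr (wordOf a b i) :=
  tr_prePow_append (tr_pre_cons.2 ⟨rfl, tr_nil _⟩)

theorem tr_wordProc_prefix {a b : A} {i : ℕ} {α : List A} (h : (wordProc a b i).Tr α) :
    ∃ β, wordOf a b i = α ++ β := by
  unfold wordProc wordOf at *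
  generalize i + 1 = k at *
  induction k generalizing α with
  | zero =>
    rcases (one_pre_nil b α).1 h with rfl | rfl
    · exact ⟨_, rfl⟩
    · exact ⟨[], rfl⟩
  | succ k ih =>
    cases α with
    | nil => exact ⟨_, rfl⟩
    | cons c α =>
      obtain ⟨rfl, h⟩ := tr_pre_cons.1 h
      obtain ⟨β, hβ⟩ := ih h
      exact ⟨β, by simp [List.replicate_succ, ← hβ]⟩

/-- The process `a ‖ aⁱ⁺¹ b` performs `aʲ⁺¹ b a` only if `j = i`. -/
theorem eq_of_tr_par_wordProc {a b : A} (hab : a ≠ b) {i j : ℕ}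
    (h : (par (pre a nil) (wordProc a b i)).Tr (wordOf a b j ++ [a])) : j = i := by
  classical
  obtain ⟨α, β, hs, hα, hβ⟩ := tr_par.1 h
  obtain ⟨δ, hδ⟩ := tr_wordProc_prefix hβ
  have hαb : α.count b = 0 := by
    rcases (one_pre_nil a α).1 hα with rfl | rfl <;> simp [hab]
  have hbβ : b ∈ β := by
    have := hs.count b
    rw [hαb, zero_add] at this
    refine List.count_pos_iff.1 (this ▸ List.count_pos_iff.2 ?_)
    simp [wordOf]
  -- The only `b` of `aⁱ⁺¹ b` is its last letter, and it has been used; so the right component has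
  -- run to its end.
  have hδ0 : δ = [] := by
    rcases List.eq_nil_or_concat δ with h | ⟨δ', c, rfl⟩
    · exact h
    · rw [wordOf, List.concat_eq_append, ← List.append_assoc] at hδ
      have h1 := (List.append_inj' hδ rfl).1
      have h2 : b ∈ List.replicate (i + 1) a := h1 ▸ List.mem_append_left _ hbβ
      exact (hab (List.eq_of_mem_replicate h2).symm).elim
  subst hδ0
  rw [List.append_nil] at hδ
  subst hδ
  -- The final `a` after `b` can only come from the left component; comparing lengths then gives `j
  -- = i`.
  rcases (one_pre_nil a α).1 hα with rfl | rfl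
  · have := hs.eq_of_nil_left rfl
    rw [← List.append_nil (wordOf a b i)] at this
    simpa using (wordOf_append_inj hab this).2
  · have := hs.length
    simp [wordOf] at this
    omega

theorem tr_wordSum {a b : A} {N i : ℕ} (hi : i < N) :
    (wordSum a b N).Tr (b :: wordOf a b i) :=
  ⟨_, step_wordSum.2 ⟨rfl, i, hi, rfl⟩, tr_wordProc a b i⟩

theorem not_tr_wordSum {a b : A} (hab : a ≠ b) (N : ℕ) : ¬ (wordSum a b N).Tr [b, b] := by
  rintro ⟨r, hr, h⟩
  obtain ⟨-, i, -, rfl⟩ := step_wordSum.1 hr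
  exact hab.symm (tr_pre_cons.1 h).1

theorem eq_of_tr_wordSum {a b c : A} {N : ℕ} (h : (wordSum a b N).Tr [c]) : c = b := by
  obtain ⟨r, hr, -⟩ := h
  exact (step_wordSum.1 hr).1

/-! ### Constrained processes and preservation by a single axiom -/

/-- The constraints on the transitions of `a ‖ (b a b + b a² b + ⋯ + b aᴺ b)` that matter for the
invariant. -/
def IsConstrained (a b : A) (N : ℕ) (t : Term A) : Prop :=
  (∀ r, Step t a r → TrEq r (wordSum a b N)) ∧
  ∀ r, Step t b r → ∀ i j, r.Tr (wordOf a b i ++ [a]) → r.Tr (wordOf a b j ++ [a]) → i = j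

theorem FutEq.isConstrained {a b : A} {N : ℕ} {t u : Term A} (h : FutEq t u)
    (ht : IsConstrained a b N t) : IsConstrained a b N u := by
  refine ⟨fun r' hr' => ?_, fun r' hr' i j hi hj => ?_⟩
  · obtain ⟨r, h1, h2⟩ := (h a).2 r' hr'
    exact h2.symm.trans (ht.1 r h1)
  · obtain ⟨r, h1, h2⟩ := (h b).2 r' hr'
    exact ht.2 r h1 i j ((h2 _).2 hi) ((h2 _).2 hj)

namespace IsConstrained

variable {a b : A} {N : ℕ} {t u : Term A}

theorem sum_left (h : IsConstrained a b N (sum t u)) : IsConstrained a b N t :=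
  ⟨fun r hr => h.1 r (.sumLeft _ hr), fun r hr => h.2 r (.sumLeft _ hr)⟩

theorem sum_right (h : IsConstrained a b N (sum t u)) : IsConstrained a b N u :=
  ⟨fun r hr => h.1 r (.sumRight _ hr), fun r hr => h.2 r (.sumRight _ hr)⟩

theorem par_comm (h : IsConstrained a b N (par t u)) : IsConstrained a b N (par u t) := by
  refine ⟨fun r hr => ?_, fun r hr i j hi hj => ?_⟩
  · rcases step_par_iff.1 hr with ⟨r', hr', rfl⟩ | ⟨r', hr', rfl⟩
    · exact (TrEq.par_comm _ _).trans (h.1 _ (.parRight _ hr'))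
    · exact (TrEq.par_comm _ _).trans (h.1 _ (.parLeft _ hr'))
  · rcases step_par_iff.1 hr with ⟨r', hr', rfl⟩ | ⟨r', hr', rfl⟩
    · exact h.2 _ (.parRight _ hr') i j ((TrEq.par_comm _ _ _).1 hi)
        ((TrEq.par_comm _ _ _).1 hj)
    · exact h.2 _ (.parLeft _ hr') i j ((TrEq.par_comm _ _ _).1 hi)
        ((TrEq.par_comm _ _ _).1 hj)

theorem of_zero_left (h : IsConstrained a b N (par t u)) (ht : Zero t) :
    IsConstrained a b N u :=
  ⟨fun r hr => (ht.trEq_par_left r).symm.trans (h.1 _ (.parRight _ hr)),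
    fun _ hr i j hi hj => h.2 _ (.parRight _ hr) i j (hi.par_right _) (hj.par_right _)⟩

/-- Once `v` has spent its `a`, the first constraint gives `w` the traces of `wordSum a b N`. If `v`
instead keeps its `a` until the end, it extends each `aⁱ⁺¹ b` of a `b`-derivative of `w` by `a`, so
the second constraint allows one `i` per derivative. Fewer than `N` prefixes cannot cover `N`
indices. -/
theorem exists_head {σ : ℕ → Term A} {v w : Term A}
    (h : IsConstrained a b N (par (v.subst σ) (w.subst σ))) (hab : a ≠ b)
    (hv : One a (v.subst σ)) (hN : w.numPrefixes < N) :
    ∃ x s, Head x w s ∧ Zero (s.subst σ) ∧ (σ x).Tr [b] := by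
  obtain ⟨r, hr, -⟩ := (hv [a]).2 (.inr rfl)
  have hr0 : Zero r := by
    intro α hα
    have : (v.subst σ).Tr (a :: α) := ⟨r, hr, hα⟩
    simpa [hv _] using this
  have e := (hr0.trEq_par_left (w.subst σ)).symm.trans (h.1 _ (.parLeft _ hr))
  refine (exists_head_or_finset (a := a) (fun c hc => eq_of_tr_wordSum ((e _).1 hc))
    (fun hb => not_tr_wordSum hab N ((e _).1 hb)) fun q hq i j hi hj => ?_).resolve_right ?_
  · have key : ∀ {i}, q.Tr (wordOf a b i) →
        (par (v.subst σ) q).Tr (wordOf a b i ++ [a]) := fun hi =>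
      tr_par.2 ⟨_, _, (Shuffle.append _ _).symm, (hv [a]).2 (.inr rfl), hi⟩
    exact h.2 _ (.parRight _ hq) i j (key hi) (key hj)
  · rintro ⟨F, hF, hF'⟩
    have : Finset.range N ⊆ F := fun i hi =>
      hF' i ((e _).2 (tr_wordSum (Finset.mem_range.1 hi)))
    have := Finset.card_le_card this
    rw [Finset.card_range] at this
    omega

end IsConstrained

/-- The two alternatives say where the parallel summand originates: its `‖` belongs to `t`, or it
lies inside `σ x`. Components that cannot move are absorbed into the context. -/
theorem HasParSummand.exists_head {a b : A} {N : ℕ} {σ : ℕ → Term A} {t : Term A}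
    (h : (t.subst σ).HasParSummand a) (hab : a ≠ b) (hc : IsConstrained a b N (t.subst σ))
    (hN : t.numPrefixes < N) :
    ∃ x s, Head x t s ∧ ((One a (s.subst σ) ∧ (σ x).Tr [b]) ∨
      (Zero (s.subst σ) ∧ (σ x).HasParSummand a)) := by
  induction t with
  | nil => exact h.elim
  | var x => exact ⟨x, nil, .var, .inr ⟨zero_nil, h⟩⟩
  | pre _ _ _ => exact h.elim
  | sum t u iht ihu =>
    simp only [numPrefixes] at hN
    rcases h with h | h
    · obtain ⟨x, s, h1, h2⟩ := iht h hc.sum_left (by omega)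
      exact ⟨x, s, .sumLeft _ h1, h2⟩
    · obtain ⟨x, s, h1, h2⟩ := ihu h hc.sum_right (by omega)
      exact ⟨x, s, .sumRight _ h1, h2⟩
  | par t u iht ihu =>
    simp only [numPrefixes] at hN
    have hz : ∀ {s w : Term A} {x : ℕ}, Zero w →
        ((One a s ∧ (σ x).Tr [b]) ∨ (Zero s ∧ (σ x).HasParSummand a)) →
        ((One a (par s w) ∧ (σ x).Tr [b]) ∨ (Zero (par s w) ∧ (σ x).HasParSummand a)) := by
      intro s w x hw h
      refine h.imp (fun h => ⟨(hw.trEq_par_right s).symm.one h.1, h.2⟩)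
        (fun h => ⟨zero_par.2 ⟨h.1, hw⟩, h.2⟩)
    rcases h with ⟨h1, h⟩ | ⟨h, h1⟩ | ⟨h1, -⟩ | ⟨-, h1⟩
    · obtain ⟨x, s, h2, h3⟩ := ihu h (hc.of_zero_left h1) (by omega)
      exact ⟨x, _, .parRight _ h2, hz h1 h3⟩
    · obtain ⟨x, s, h2, h3⟩ := iht h (hc.par_comm.of_zero_left h1) (by omega)
      exact ⟨x, _, .parLeft _ h2, hz h1 h3⟩
    · obtain ⟨x, s, h2, h3, h4⟩ := hc.exists_head hab h1 (by omega)
      exact ⟨x, _, .parRight _ h2, .inl ⟨(h3.trEq_par_left _).symm.one h1, h4⟩⟩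
    · obtain ⟨x, s, h2, h3, h4⟩ := hc.par_comm.exists_head hab h1 (by omega)
      exact ⟨x, _, .parLeft _ h2, .inl ⟨(h3.trEq_par_left _).symm.one h1, h4⟩⟩

/-- Equations with few prefixes that are valid modulo `FutEq` preserve the invariant. -/
theorem HasParSummand.of_valid {a b : A} (hab : a ≠ b) {N : ℕ} {t u : Term A}
    (hv : ∀ σ : ℕ → Term A, (∀ y, (σ y).IsClosed) → FutEq (t.subst σ) (u.subst σ))
    (hN : t.numPrefixes < N) {σ : ℕ → Term A} (hσ : ∀ y, (σ y).IsClosed)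
    (hc : IsConstrained a b N (t.subst σ)) (h : (t.subst σ).HasParSummand a) :
    (u.subst σ).HasParSummand a := by
  classical
  obtain ⟨x, s, h1, h2⟩ := h.exists_head hab hc hN
  -- An occurrence of `x` in the context would give it a trace ending in `b`, or a nonempty trace
  -- where none exists.
  have hx : ¬ s.Occurs x := by
    intro hx
    rcases h2 with ⟨h2, h3⟩ | ⟨h2, h3⟩
    · obtain ⟨α, hα⟩ := hx.exists_tr h3
      rcases (h2 _).1 hα with h4 | h4
      · simp at h4
      · have := congrArg List.getLast? h4
        simp at this
        exact hab this.symm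
    · obtain ⟨c, q, hq⟩ := exists_step_of_not_zero h3.not_zero
      obtain ⟨α, hα⟩ := hx.exists_tr (α := [c]) ⟨q, hq, tr_nil q⟩
      simpa using h2 _ hα
  have hb : ∀ α, (s.subst σ).Tr α → b ∉ α := by
    intro α hα hb
    rcases h2 with ⟨h2, -⟩ | ⟨h2, -⟩
    · rcases (h2 _).1 hα with rfl | rfl
      · simp at hb
      · simp at hb; exact hab hb.symm
    · rw [h2 _ hα] at hb
      simp at hb
  obtain ⟨s', h3, h4⟩ := h1.transfer hv hσ hx hb
  refine h3.hasParSummand (h2.imp (fun h2 => ⟨h4.one h2.1, fun hz => ?_⟩)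
    (fun h2 => ⟨h4.zero h2.1, h2.2⟩))
  simpa using hz _ h2.2

end Term

/-! ### Preservation along derivations -/

open Term

/-- Both claims are proved together, since `FutEq` carries the constraint across symmetry and
transitivity. Quantifying over all closed `σ` absorbs the substitution rule. For `‖`, the invariant
descends into a component only when the other cannot move, which is exactly when the constraint
descends too. -/
theorem Derives.futEq_and_hasParSummand {A : Type*} {a b : A} (hab : a ≠ b) {N : ℕ}
    {E : AxiomSystem A}
    (hE : ∀ t u, (t, u) ∈ E → ∀ σ : ℕ → Term A, (∀ y, (σ y).IsClosed) →
      FutEq (t.subst σ) (u.subst σ))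
    (hN : ∀ t u, (t, u) ∈ E → t.numPrefixes < N ∧ u.numPrefixes < N)
    {t u : Term A} (h : Derives E t u) (σ : ℕ → Term A) (hσ : ∀ y, (σ y).IsClosed) :
    FutEq (t.subst σ) (u.subst σ) ∧ (IsConstrained a b N (t.subst σ) →
      ((t.subst σ).HasParSummand a ↔ (u.subst σ).HasParSummand a)) := by
  induction h generalizing σ with
  | ax h =>
    refine ⟨hE _ _ h σ hσ, fun hc => ⟨?_, ?_⟩⟩
    · exact HasParSummand.of_valid hab (hE _ _ h) (hN _ _ h).1 hσ hc
    · exact HasParSummand.of_valid hab (fun τ hτ => (hE _ _ h τ hτ).symm) (hN _ _ h).2 hσ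
        ((hE _ _ h σ hσ).isConstrained hc)
  | refl t => exact ⟨.refl _, fun _ => Iff.rfl⟩
  | symm _ ih =>
    obtain ⟨h1, h2⟩ := ih σ hσ
    exact ⟨h1.symm, fun hc => (h2 (h1.symm.isConstrained hc)).symm⟩
  | trans _ _ ih ih' =>
    obtain ⟨h1, h2⟩ := ih σ hσ
    obtain ⟨h3, h4⟩ := ih' σ hσ
    exact ⟨h1.trans h3, fun hc => (h2 hc).trans (h4 (h1.isConstrained hc))⟩
  | @subst t u τ _ ih =>
    have e : ∀ v : Term A, (v.subst τ).subst σ = v.subst fun y => (τ y).subst σ := by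
      intro v
      induction v with
      | nil => rfl
      | var _ => rfl
      | pre _ _ ih => simp only [Term.subst]; rw [ih]
      | sum _ _ ih ih' => simp only [Term.subst]; rw [ih, ih']
      | par _ _ ih ih' => simp only [Term.subst]; rw [ih, ih']
    rw [e, e]
    exact ih _ fun y => isClosed_subst hσ (τ y)
  | pre c _ ih => exact ⟨(ih σ hσ).1.pre c, fun _ => Iff.rfl⟩
  | sum _ _ ih ih' =>
    obtain ⟨h1, h2⟩ := ih σ hσ
    obtain ⟨h3, h4⟩ := ih' σ hσ
    exact ⟨h1.sum h3, fun hc => or_congr (h2 hc.sum_left) (h4 hc.sum_right)⟩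
  | @par t u t' u' _ _ ih ih' =>
    obtain ⟨h1, h2⟩ := ih σ hσ
    obtain ⟨h3, h4⟩ := ih' σ hσ
    refine ⟨h1.par h3, fun hc => ?_⟩
    have z1 : Zero (t.subst σ) ↔ Zero (u.subst σ) := ⟨h1.trEq.zero, h1.trEq.symm.zero⟩
    have z2 : Zero (t'.subst σ) ↔ Zero (u'.subst σ) := ⟨h3.trEq.zero, h3.trEq.symm.zero⟩
    have o1 : One a (t.subst σ) ↔ One a (u.subst σ) := ⟨h1.trEq.one, h1.trEq.symm.one⟩
    have o2 : One a (t'.subst σ) ↔ One a (u'.subst σ) := ⟨h3.trEq.one, h3.trEq.symm.one⟩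
    simp only [Term.subst, HasParSummand, ← z1, ← z2, ← o1, ← o2]
    refine or_congr (and_congr_right fun hz => h4 (hc.of_zero_left hz)) (or_congr_left ?_)
    exact and_congr_left fun hz => h2 (hc.par_comm.of_zero_left hz)

theorem Term.subst_of_isClosed {A : Type*} {t : Term A} (h : t.IsClosed) (σ : ℕ → Term A) :
    t.subst σ = t := by
  induction t with
  | nil => rfl
  | var _ => exact h.elim
  | pre _ _ ih => simp only [Term.subst]; rw [ih h]
  | sum _ _ ih ih' => simp only [Term.subst]; rw [ih h.1, ih' h.2]
  | par _ _ ih ih' => simp only [Term.subst]; rw [ih h.1, ih' h.2]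

theorem Term.Step.isClosed {A : Type*} {t r : Term A} {c : A} (h : Term.Step t c r)
    (ht : t.IsClosed) : r.IsClosed := by
  induction h with
  | pre => exact ht
  | sumLeft _ _ ih => exact ih ht.1
  | sumRight _ _ ih => exact ih ht.2
  | parLeft _ _ ih => exact ⟨ih ht.1, ht.2⟩
  | parRight _ _ ih => exact ⟨ht.1, ih ht.2⟩

/-! ### Nested equivalences compared with `FutEq` and with equality of transitions -/

namespace Proc

variable {A : Type*}

theorem tr_iff_exists_steps {p : Proc A} {α : List A} : p.1.Tr α ↔ ∃ q, Steps p α q := by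
  induction α generalizing p with
  | nil => simpa using ⟨p, Steps.nil p⟩
  | cons c α ih =>
    constructor
    · rintro ⟨r, hr, h⟩
      obtain ⟨q, hq⟩ := (ih (p := ⟨r, hr.isClosed p.2⟩)).1 h
      exact ⟨q, .cons (p' := ⟨r, hr.isClosed p.2⟩) hr hq⟩
    · rintro ⟨q, h⟩
      cases h with
      | cons h h' => exact ⟨_, h, ih.2 ⟨q, h'⟩⟩

theorem nestedTraceEquiv_one {p q : Proc A} : NestedTraceEquiv 1 p q ↔ TrEq p.1 q.1 := by
  simp only [NestedTraceEquiv, and_true, TrEq, tr_iff_exists_steps]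
  exact forall_congr' fun α => ⟨fun h => ⟨fun ⟨r, hr⟩ => h.1 r hr, fun ⟨r, hr⟩ => h.2 r hr⟩,
    fun h => ⟨fun r hr => h.1 ⟨r, hr⟩, fun r hr => h.2 ⟨r, hr⟩⟩⟩

theorem Steps.of_step {p q : Proc A} {c : A} (h : Step p c q) : Steps p [c] q :=
  .cons h (.nil q)

theorem Steps.step {p q : Proc A} {c : A} (h : Steps p [c] q) : Step p c q := by
  cases h with
  | cons h h' => cases h'; exact h

theorem futEq_of_nestedTraceEquiv_two {p q : Proc A} (h : NestedTraceEquiv 2 p q) :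
    FutEq p.1 q.1 := by
  refine fun c => ⟨fun r hr => ?_, fun r hr => ?_⟩
  · obtain ⟨q', h1, h2⟩ := (h [c]).1 ⟨r, hr.isClosed p.2⟩ (.of_step hr)
    exact ⟨q'.1, h1.step, nestedTraceEquiv_one.1 h2⟩
  · obtain ⟨p', h1, h2⟩ := (h [c]).2 ⟨r, hr.isClosed q.2⟩ (.of_step hr)
    exact ⟨p'.1, h1.step, nestedTraceEquiv_one.1 h2⟩

theorem NestedTraceEquiv.of_succ {n : ℕ} {p q : Proc A} (h : NestedTraceEquiv (n + 1) p q) :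
    NestedTraceEquiv n p q := by
  induction n generalizing p q with
  | zero => trivial
  | succ n ih =>
    refine fun α => ⟨fun p' hp' => ?_, fun q' hq' => ?_⟩
    · obtain ⟨q', h1, h2⟩ := (h α).1 p' hp'
      exact ⟨q', h1, ih h2⟩
    · obtain ⟨p', h1, h2⟩ := (h α).2 q' hq'
      exact ⟨p', h1, ih h2⟩

theorem NestedTraceEquiv.mono {m n : ℕ} (hmn : m ≤ n) {p q : Proc A}
    (h : NestedTraceEquiv n p q) : NestedTraceEquiv m p q := by
  induction hmn with
  | refl => exact h
  | step _ ih => exact ih h.of_succ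

theorem NestedSim.of_succ {n : ℕ} {p q : Proc A} (h : NestedSim (n + 1) p q) :
    NestedSim n p q := by
  induction n generalizing p q with
  | zero => trivial
  | succ n ih =>
    obtain ⟨R, h1, h2, h3⟩ := h
    exact ⟨R, h1, fun r s hrs => ih (h2 r s hrs), h3⟩

theorem NestedSim.mono {m n : ℕ} (hmn : m ≤ n) {p q : Proc A}
    (h : NestedSim n p q) : NestedSim m p q := by
  induction hmn with
  | refl => exact h
  | step _ ih => exact ih h.of_succ

theorem NestedSim.step {n : ℕ} {p q p' : Proc A} {c : A} (h : NestedSim (n + 1) p q)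
    (hp : Step p c p') : ∃ q', Step q c q' ∧ NestedSim (n + 1) p' q' := by
  obtain ⟨R, h1, h2, h3⟩ := h
  obtain ⟨q', h4, h5⟩ := h1 p q h3 c p' hp
  exact ⟨q', h4, R, h1, h2, h5⟩

theorem NestedSim.flip {n : ℕ} {p q : Proc A} (h : NestedSim (n + 1) p q) :
    NestedSim n q p := by
  obtain ⟨R, -, h2, h3⟩ := h
  exact h2 p q h3

theorem NestedSim.tr {p q : Proc A} (h : NestedSim 1 p q) {α : List A} (hα : p.1.Tr α) :
    q.1.Tr α := by
  induction α generalizing p q with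
  | nil => simp
  | cons c α ih =>
    obtain ⟨r, hr, hα⟩ := hα
    obtain ⟨q', h1, h2⟩ := h.step (p' := ⟨r, hr.isClosed p.2⟩) hr
    exact ⟨q'.1, h1, ih h2 hα⟩

/-- Matched derivatives are related by the preorder of level 2, which contains mutual similarity at
level 1 and hence trace equality. -/
theorem futEq_of_nestedSimEquiv_two {p q : Proc A} (h : NestedSimEquiv 2 p q) :
    FutEq p.1 q.1 := by
  refine FutEq.of_forall
    (P := fun t u => ∃ p q : Proc A, NestedSim 2 p q ∧ NestedSim 2 q p ∧ t = p.1 ∧ u = q.1)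
    ⟨p, q, h.1, h.2, rfl, rfl⟩ (fun t u ⟨p, q, h1, h2, h3, h4⟩ => ⟨q, p, h2, h1, h4, h3⟩) ?_
  rintro _ _ ⟨p, q, h, -, rfl, rfl⟩ c r hr
  obtain ⟨q', h1, h2⟩ := h.step (p' := ⟨r, hr.isClosed p.2⟩) hr
  exact ⟨q'.1, h1, fun α => ⟨fun hα => h2.of_succ.tr hα, fun hα => h2.flip.tr hα⟩⟩

theorem NestedTraceEquiv.refl (n : ℕ) (p : Proc A) : NestedTraceEquiv n p p := by
  induction n generalizing p with
  | zero => trivial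
  | succ n ih => exact fun α => ⟨fun p' h => ⟨p', h, ih p'⟩, fun p' h => ⟨p', h, ih p'⟩⟩

/-- A nonempty trace leads both processes to the very same process; only the empty one needs the
induction. -/
theorem nestedTraceEquiv_of_step_iff {p q : Proc A} (h : ∀ c r, Step p c r ↔ Step q c r)
    (n : ℕ) : NestedTraceEquiv n p q := by
  induction n with
  | zero => trivial
  | succ n ih =>
    refine fun α => ⟨fun p' hp => ?_, fun q' hq => ?_⟩
    · cases hp with
      | nil => exact ⟨q, .nil q, ih⟩
      | cons h1 h2 => exact ⟨p', .cons ((h _ _).1 h1) h2, .refl n p'⟩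
    · cases hq with
      | nil => exact ⟨p, .nil p, ih⟩
      | cons h1 h2 => exact ⟨q', .cons ((h _ _).2 h1) h2, .refl n q'⟩

theorem nestedSim_of_step_iff {p q : Proc A} (h : ∀ c r, Step p c r ↔ Step q c r)
    (n : ℕ) : NestedSim n p q := by
  suffices H : ∀ p q : Proc A, (∀ c r, Step p c r ↔ Step q c r) → NestedSim n p q from H p q h
  clear h p q
  induction n with
  | zero => exact fun _ _ _ => trivial
  | succ n ih =>
    intro p q h
    refine ⟨fun p q => ∀ c r, Step p c r ↔ Step q c r, fun p q h c p' hp => ?_,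
      fun r s hrs => ih s r fun c q => (hrs c q).symm, h⟩
    exact ⟨p', (h c p').1 hp, fun _ _ => Iff.rfl⟩

end Proc

/-! ### The separating equations and the conclusion -/

namespace Term

variable {A : Type*}

theorem isClosed_wordProc (a b : A) (i : ℕ) : (wordProc a b i).IsClosed :=
  isClosed_prePow a (i + 1) (t := pre b nil) trivial

theorem isClosed_wordSum (a b : A) (N : ℕ) : (wordSum a b N).IsClosed := by
  induction N with
  | zero => trivial
  | succ N ih => exact ⟨ih, isClosed_wordProc a b N⟩

theorem isClosed_parWordSum (a b : A) (N : ℕ) : (parWordSum a b N).IsClosed := by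
  induction N with
  | zero => trivial
  | succ N ih => exact ⟨ih, trivial, isClosed_wordProc a b N⟩

theorem not_hasParSummand_parWordSum (a b : A) (N : ℕ) :
    ¬ (parWordSum a b N).HasParSummand a := by
  induction N with
  | zero => exact id
  | succ N ih => exact fun h => h.elim ih id

theorem isConstrained_par_wordSum {a b : A} (hab : a ≠ b) (N : ℕ) :
    IsConstrained a b N (par (pre a nil) (wordSum a b N)) := by
  refine ⟨fun r hr => ?_, fun r hr i j hi hj => ?_⟩
  · rcases step_par_iff.1 hr with ⟨r, h, rfl⟩ | ⟨r, h, rfl⟩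
    · obtain ⟨-, rfl⟩ := step_pre_iff.1 h
      exact zero_nil.trEq_par_left _
    · exact (hab (step_wordSum.1 h).1).elim
  · rcases step_par_iff.1 hr with ⟨r, h, rfl⟩ | ⟨r, h, rfl⟩
    · exact (hab (step_pre_iff.1 h).1.symm).elim
    · obtain ⟨-, k, -, rfl⟩ := step_wordSum.1 h
      rw [eq_of_tr_par_wordProc hab hi, eq_of_tr_par_wordProc hab hj]

end Term

/-- No relation that contains equality of transitions and is contained in `FutEq` has a finite
sound and ground-complete axiomatisation. -/
theorem not_hasFiniteGroundCompleteAxiomatisation {A : Type*} {a b : A} (hab : a ≠ b)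
    {R : Proc A → Proc A → Prop}
    (hR : ∀ p q : Proc A, (∀ c r, Proc.Step p c r ↔ Proc.Step q c r) → R p q)
    (hR' : ∀ p q, R p q → FutEq p.1 q.1) :
    ¬ HasFiniteGroundCompleteAxiomatisation R := by
  rintro ⟨E, hfin, hsound, hcomplete⟩
  obtain ⟨N, hN⟩ : ∃ N, ∀ e ∈ E, e.1.numPrefixes + e.2.numPrefixes ≤ N := by
    obtain ⟨N, hN⟩ := (hfin.image fun e => e.1.numPrefixes + e.2.numPrefixes).bddAbove
    exact ⟨N, fun e he => hN ⟨e, he, rfl⟩⟩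
  let p : Proc A := ⟨par (pre a nil) (wordSum a b (N + 1)), trivial, isClosed_wordSum a b _⟩
  -- The idle `nil` is kept so that the derivatives of `p` and `q` coincide syntactically.
  let q : Proc A := ⟨sum (pre a (par nil (wordSum a b (N + 1)))) (parWordSum a b (N + 1)),
    ⟨trivial, isClosed_wordSum a b _⟩, isClosed_parWordSum a b _⟩
  have hpq : R p q := hR p q fun c r => by
    simp only [Proc.Step, p, q, step_par_iff, step_sum_iff, step_pre_iff, step_wordSum,
      step_parWordSum]
    refine or_congr ?_ ?_
    · constructor
      · rintro ⟨_, ⟨rfl, rfl⟩, h⟩; exact ⟨rfl, h⟩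
      · rintro ⟨rfl, h⟩; exact ⟨_, ⟨rfl, rfl⟩, h⟩
    · constructor
      · rintro ⟨_, ⟨rfl, i, hi, rfl⟩, h⟩; exact ⟨rfl, i, hi, h⟩
      · rintro ⟨rfl, i, hi, h⟩; exact ⟨_, ⟨rfl, i, hi, rfl⟩, h⟩
  have key := (hcomplete p q hpq).futEq_and_hasParSummand hab (N := N + 1)
    (fun t u h σ hσ => hR' _ _ (hsound t u h fun y => ⟨σ y, hσ y⟩))
    (fun t u h => by have := hN _ h; constructor <;> simp only at this <;> omega)
    (fun _ => nil) (fun _ => trivial)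
  rw [subst_of_isClosed p.2, subst_of_isClosed q.2] at key
  have hp : p.1.HasParSummand a := .inr (.inr (.inl ⟨one_pre_nil a, fun hz => by
    simpa using hz _ (tr_wordSum (a := a) (b := b) (Nat.succ_pos N))⟩))
  -- Every summand of `q` is a prefix, so `q` lacks the invariant.
  exact ((key.2 (isConstrained_par_wordSum hab _)).1 hp).elim id
    (not_hasParSummand_parWordSum a b _)

end BCCSP

theorem mainTheorem3 {A : Type*} [Finite A] (hA : 2 ≤ Nat.card A) (n : ℕ) (hn : 2 ≤ n) :
    ¬ BCCSP.HasFiniteGroundCompleteAxiomatisation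
        (BCCSP.Proc.NestedTraceEquiv (A := A) n) ∧
    ¬ BCCSP.HasFiniteGroundCompleteAxiomatisation
        (BCCSP.Proc.NestedSimEquiv (A := A) n) := by
  have := Finite.one_lt_card_iff_nontrivial.1 hA
  obtain ⟨a, b, hab⟩ := exists_pair_ne A
  exact ⟨BCCSP.not_hasFiniteGroundCompleteAxiomatisation hab
      (fun p q h => BCCSP.Proc.nestedTraceEquiv_of_step_iff h n)
      (fun p q h => BCCSP.Proc.futEq_of_nestedTraceEquiv_two (h.mono hn)),
    BCCSP.not_hasFiniteGroundCompleteAxiomatisation hab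
      (fun p q h => ⟨BCCSP.Proc.nestedSim_of_step_iff h n,
        BCCSP.Proc.nestedSim_of_step_iff (fun c r => (h c r).symm) n⟩)
      (fun p q h => BCCSP.Proc.futEq_of_nestedSimEquiv_two ⟨h.1.mono hn, h.2.mono hn⟩)⟩
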